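/- Let $A=(a_{ij})$ be an integer $d\times n$ matrix with columns $\mathbf a_1,\dots,\mathbf a_n\in\mathbb Z^d$, and let $\mathbb NA$, $\mathbb ZA$ and $\mathbb R_{\ge 0}A$ be the semigroup, the group and the real cone generated by the columns. Assume that $A$ is pointed, $\mathbb NA\cap(-\mathbb NA)=\{0\}$, and saturated, $\mathbb R_{\ge 0}A\cap\mathbb ZA=\mathbb NA$. Let $\operatorname{Int}(\mathbb NA)$ be the set of elements of $\mathbb NA$ that lie on no proper face of $\mathbb NA$, where a face is the zero locus in $\mathbb NA$ of a linear functional on $\mathbb R^d$ that is nonnegative on $\mathbb NA$. Let $D_A=\mathbb C\langle x_1,\dots,x_n,\partial_1,\dots,\partial_n\rangle$ be the $n$-th Weyl algebra. For $\beta\in\mathbb C^d$ let $H_A(\beta)\subseteq D_A$ be the left ideal generated by all $\partial^{\mathbf s}-\partial^{\mathbf t}$ with $\mathbf s,\mathbf t\in\mathbb N^n$, $A\cdot\mathbf s=A\cdot\mathbf t$, and by $\sum_{j=1}^n a_{ij}x_j\partial_j-\beta_i$ for $i=1,\dots,d$; put $M_A^\beta=D_A/H_A(\beta)$. For $\mathbf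 u\in\mathbb N^n$, right multiplication by $\partial^{\mathbf u}$ induces a $D_A$-linear contiguity map $M_A^{\beta-A\cdot\mathbf u}\to M_A^{\beta}$. (1) Let $\mathbf u,\mathbf v\in\mathbb N^n$, $\mathbf a=A\cdot\mathbf u$ and $\mathbf b=A\cdot\mathbf v$. If $\mathbf b\in\operatorname{Int}(\mathbb NA)$, then the contiguity map $$M_A^{-\mathbf a-\mathbf b}\xrightarrow{\ \cdot\partial^{\mathbf u}\ }M_A^{-\mathbf b}$$ is an isomorphism. (2) For every $\mathbf v\in\mathbb N^n$ with $\mathbf b=A\cdot\mathbf v\in\operatorname{Int}(\mathbb NA)$, the $D_A$-submodule of $M_A^0$ generated by the class of $\partial^{\mathbf v}$ is the image of the contiguity map $M_A^{-\mathbf b}\xrightarrow{\cdot\partial^{\mathbf v}}M_A^0$, and this submodule is the same for all such $\mathbf v$. -/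

import Mathlib

namespace GKZ

/-! ### The Weyl algebra -/

/-- Defining relations of the `n`-th complex Weyl algebra; the generator `Sum.inl j` is the
coordinate `x_j`, the generator `Sum.inr j` is the partial derivative `∂_j`. -/
inductive WeylRel (n : ℕ) :
    FreeAlgebra ℂ (Fin n ⊕ Fin n) → FreeAlgebra ℂ (Fin n ⊕ Fin n) → Prop
  | x_comm (i j : Fin n) :
      WeylRel n (FreeAlgebra.ι ℂ (Sum.inl i) * FreeAlgebra.ι ℂ (Sum.inl j))
        (FreeAlgebra.ι ℂ (Sum.inl j) * FreeAlgebra.ι ℂ (Sum.inl i))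
  | d_comm (i j : Fin n) :
      WeylRel n (FreeAlgebra.ι ℂ (Sum.inr i) * FreeAlgebra.ι ℂ (Sum.inr j))
        (FreeAlgebra.ι ℂ (Sum.inr j) * FreeAlgebra.ι ℂ (Sum.inr i))
  | d_x (i j : Fin n) :
      WeylRel n (FreeAlgebra.ι ℂ (Sum.inr i) * FreeAlgebra.ι ℂ (Sum.inl j))
        (FreeAlgebra.ι ℂ (Sum.inl j) * FreeAlgebra.ι ℂ (Sum.inr i) + if i = j then 1 else 0)

/-- The `n`-th complex Weyl algebra `ℂ⟨x_1, …, x_n, ∂_1, …, ∂_n⟩`. -/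
def WeylAlgebra (n : ℕ) : Type := RingQuot (WeylRel n)

noncomputable instance (n : ℕ) : Ring (WeylAlgebra n) :=
  inferInstanceAs (Ring (RingQuot (WeylRel n)))

noncomputable instance (n : ℕ) : Algebra ℂ (WeylAlgebra n) :=
  inferInstanceAs (Algebra ℂ (RingQuot (WeylRel n)))

/-- The quotient map from the free algebra. -/
noncomputable def weylMk (n : ℕ) : FreeAlgebra ℂ (Fin n ⊕ Fin n) →ₐ[ℂ] WeylAlgebra n :=
  RingQuot.mkAlgHom ℂ (WeylRel n)

theorem weylMk_rel {n : ℕ} {p q : FreeAlgebra ℂ (Fin n ⊕ Fin n)} (h : WeylRel n p q) :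
    weylMk n p = weylMk n q :=
  RingQuot.mkAlgHom_rel ℂ h

/-- The coordinate `x_j`. -/
noncomputable def coord {n : ℕ} (j : Fin n) : WeylAlgebra n :=
  weylMk n (FreeAlgebra.ι ℂ (Sum.inl j))

/-- The partial derivative `∂_j`. -/
noncomputable def del {n : ℕ} (j : Fin n) : WeylAlgebra n :=
  weylMk n (FreeAlgebra.ι ℂ (Sum.inr j))

theorem coord_mul_coord {n : ℕ} (i j : Fin n) : coord i * coord j = coord j * coord i := by
  simpa [coord] using weylMk_rel (WeylRel.x_comm i j)

theorem del_mul_del {n : ℕ} (i j : Fin n) : del i * del j = del j * del i := by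
  simpa [del] using weylMk_rel (WeylRel.d_comm i j)

theorem del_mul_coord {n : ℕ} (i j : Fin n) :
    del i * coord j = coord j * del i + if i = j then 1 else 0 := by
  have h := weylMk_rel (WeylRel.d_x i j)
  split_ifs at h ⊢ <;> simpa [del, coord] using h

/-- The monomial `∂^u = ∂_1^{u_1} ⋯ ∂_n^{u_n}` (the `∂_j` commute with one another). -/
noncomputable def delPow {n : ℕ} (u : Fin n → ℕ) : WeylAlgebra n :=
  ((List.finRange n).map fun j => del j ^ u j).prod

/-! ### The semigroup of an integer matrix -/

/-- The `j`-th column of `A`. -/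
def column {d n : ℕ} (A : Matrix (Fin d) (Fin n) ℤ) (j : Fin n) : Fin d → ℤ := fun i => A i j

/-- The vector `A · u` for `u ∈ ℕ^n`. -/
def deg {d n : ℕ} (A : Matrix (Fin d) (Fin n) ℤ) (u : Fin n → ℕ) : Fin d → ℤ :=
  fun i => ∑ j, A i j * (u j : ℤ)

/-- The semigroup `ℕA`. -/
def semigroup {d n : ℕ} (A : Matrix (Fin d) (Fin n) ℤ) : AddSubmonoid (Fin d → ℤ) :=
  AddSubmonoid.closure (Set.range (column A))

/-- The group `ℤA`. -/
def lattice {d n : ℕ} (A : Matrix (Fin d) (Fin n) ℤ) : AddSubgroup (Fin d → ℤ) :=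
  AddSubgroup.closure (Set.range (column A))

/-- The real cone `ℝ_{≥0}A`. -/
def cone {d n : ℕ} (A : Matrix (Fin d) (Fin n) ℤ) : Set (Fin d → ℝ) :=
  {y | ∃ c : Fin n → ℝ, (∀ j, 0 ≤ c j) ∧ ∀ i, y i = ∑ j, c j * (A i j : ℝ)}

/-- `A` is pointed: `ℕA ∩ (-ℕA) = {0}`. -/
def IsPointed {d n : ℕ} (A : Matrix (Fin d) (Fin n) ℤ) : Prop :=
  ∀ w : Fin d → ℤ, w ∈ semigroup A → -w ∈ semigroup A → w = 0

/-- `A` is saturated: `ℝ_{≥0}A ∩ ℤA = ℕA`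
(which reads `ℝ_{≥0}A ∩ ℤ^d = ℕA` when `ℤA = ℤ^d`). -/
def IsSaturated {d n : ℕ} (A : Matrix (Fin d) (Fin n) ℤ) : Prop :=
  ∀ w : Fin d → ℤ, (w ∈ lattice A ∧ (fun i => (w i : ℝ)) ∈ cone A) ↔ w ∈ semigroup A

/-- `F` is a face of the semigroup `ℕA`: the zero locus on `ℕA` of a linear functional that is
nonnegative on `ℕA`. -/
def IsFace {d n : ℕ} (A : Matrix (Fin d) (Fin n) ℤ) (F : Set (Fin d → ℤ)) : Prop :=
  ∃ φ : (Fin d → ℝ) →ₗ[ℝ] ℝ,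
    (∀ w ∈ semigroup A, 0 ≤ φ fun i => (w i : ℝ)) ∧
      F = {w | w ∈ semigroup A ∧ (φ fun i => (w i : ℝ)) = 0}

/-- The interior `Int(ℕA)`: the elements of `ℕA` that lie on no proper face. -/
def interiorPoints {d n : ℕ} (A : Matrix (Fin d) (Fin n) ℤ) : Set (Fin d → ℤ) :=
  {b | b ∈ semigroup A ∧
    ∀ F : Set (Fin d → ℤ), IsFace A F → F ≠ (semigroup A : Set (Fin d → ℤ)) → b ∉ F}

/-! ### `A`-hypergeometric systems -/

/-- The Euler operator `E_i = ∑_j a_{ij} x_j ∂_j`. -/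
noncomputable def euler {d n : ℕ} (A : Matrix (Fin d) (Fin n) ℤ) (i : Fin d) : WeylAlgebra n :=
  ∑ j, algebraMap ℂ (WeylAlgebra n) (A i j : ℂ) * (coord j * del j)

/-- The left ideal `H_A(β)` generated by the toric operators `∂^s - ∂^t`, `A · s = A · t`,
and by `E_i - β_i` (`Ideal` means left ideal in Mathlib). -/
noncomputable def hyperIdeal {d n : ℕ} (A : Matrix (Fin d) (Fin n) ℤ) (β : Fin d → ℂ) :
    Ideal (WeylAlgebra n) :=
  Ideal.span
    ({P | ∃ s t : Fin n → ℕ, deg A s = deg A t ∧ P = delPow s - delPow t} ∪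
      {P | ∃ i : Fin d, P = euler A i - algebraMap ℂ (WeylAlgebra n) (β i)})

/-- The left module `M_A^β = D_A / H_A(β)`. -/
abbrev HyperModule {d n : ℕ} (A : Matrix (Fin d) (Fin n) ℤ) (β : Fin d → ℂ) : Type :=
  WeylAlgebra n ⧸ hyperIdeal A β

/-- An integer vector as a complex parameter. -/
def param {d : ℕ} (w : Fin d → ℤ) : Fin d → ℂ := fun i => (w i : ℂ)

theorem del_pow_mul_comm {n : ℕ} (i j : Fin n) (k l : ℕ) :
    (del i ^ k * del j ^ l : WeylAlgebra n) = del j ^ l * del i ^ k :=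
  ((show Commute (del i) (del j) from del_mul_del i j).pow_pow k l).eq

theorem delPow_mul_comm {n : ℕ} (u v : Fin n → ℕ) : delPow u * delPow v = delPow v * delPow u := by
  have h : Commute (delPow u) (delPow v) := by
    refine Commute.list_prod_left _ _ fun a ha => Commute.list_prod_right _ _ fun b hb => ?_
    obtain ⟨i, -, rfl⟩ := List.mem_map.1 ha
    obtain ⟨j, -, rfl⟩ := List.mem_map.1 hb
    exact del_pow_mul_comm i j _ _
  exact h.eq

/-- `E_i ∂_k = ∂_k (E_i - a_{ik})`. -/
theorem euler_mul_del {d n : ℕ} (A : Matrix (Fin d) (Fin n) ℤ) (i : Fin d) (k : Fin n) :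
    euler A i * del k =
      del k * (euler A i - algebraMap ℂ (WeylAlgebra n) (A i k : ℂ)) := by
  have h : ∀ j : Fin n, algebraMap ℂ (WeylAlgebra n) (A i j : ℂ) * (coord j * del j) * del k =
      del k * (algebraMap ℂ (WeylAlgebra n) (A i j : ℂ) * (coord j * del j))
        - if k = j then del k * algebraMap ℂ (WeylAlgebra n) (A i k : ℂ) else 0 := by
    intro j
    have e : del k * (algebraMap ℂ (WeylAlgebra n) (A i j : ℂ) * (coord j * del j)) =
        algebraMap ℂ (WeylAlgebra n) (A i j : ℂ) * ((del k * coord j) * del j) := by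
      rw [← mul_assoc, ← Algebra.commutes, mul_assoc, mul_assoc]
    rw [e, del_mul_coord, mul_assoc, mul_assoc, del_mul_del j k]
    split_ifs with hk
    · subst hk
      rw [← Algebra.commutes]
      noncomm_ring
    · noncomm_ring
  rw [euler, Finset.sum_mul, Finset.sum_congr rfl fun j _ => h j, Finset.sum_sub_distrib,
    Finset.sum_ite_eq, mul_sub, Finset.mul_sum]
  simp

/-- `E_i ∂^u = ∂^u (E_i - (A · u)_i)`. -/
theorem euler_mul_delPow {d n : ℕ} (A : Matrix (Fin d) (Fin n) ℤ) (i : Fin d) (u : Fin n → ℕ) :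
    euler A i * delPow u =
      delPow u * (euler A i - algebraMap ℂ (WeylAlgebra n) (param (deg A u) i)) := by
  have step : ∀ (p q : WeylAlgebra n) (r s : ℂ),
      euler A i * p = p * (euler A i - algebraMap ℂ (WeylAlgebra n) r) →
      euler A i * q = q * (euler A i - algebraMap ℂ (WeylAlgebra n) s) →
      euler A i * (p * q) = p * q * (euler A i - algebraMap ℂ (WeylAlgebra n) (r + s)) := by
    intro p q r s hp hq
    rw [← mul_assoc, hp, mul_assoc, sub_mul, hq, Algebra.commutes, map_add]
    noncomm_ring
  have pw : ∀ (k : Fin n) (m : ℕ), euler A i * del k ^ m =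
      del k ^ m * (euler A i - algebraMap ℂ (WeylAlgebra n) ((A i k : ℂ) * m)) := by
    intro k m
    induction m with
    | zero => simp
    | succ m ih =>
      rw [pow_succ, step _ _ _ _ ih (euler_mul_del A i k)]
      congr 3
      push_cast
      ring
  have lst : ∀ l : List (Fin n), euler A i * (l.map fun j => del j ^ u j).prod =
      (l.map fun j => del j ^ u j).prod *
        (euler A i - algebraMap ℂ (WeylAlgebra n) (l.map fun j => (A i j : ℂ) * (u j : ℂ)).sum) := by
    intro l
    induction l with
    | nil => simp
    | cons k l ih =>
      simp only [List.map_cons, List.prod_cons, List.sum_cons]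
      exact step _ _ _ _ (pw k _) ih
  have hs : ((List.finRange n).map fun j => (A i j : ℂ) * (u j : ℂ)).sum = param (deg A u) i := by
    rw [← List.ofFn_eq_map, List.sum_ofFn]
    simp [param, deg]
  rw [delPow, lst, hs]

/-- Right multiplication by `∂^u` sends `H_A(β - A · u)` into `H_A(β)`. -/
theorem hyperIdeal_le_comap {d n : ℕ} (A : Matrix (Fin d) (Fin n) ℤ) (β : Fin d → ℂ)
    (u : Fin n → ℕ) :
    hyperIdeal A (β - param (deg A u)) ≤
      Submodule.comap (LinearMap.toSpanSingleton (WeylAlgebra n) (WeylAlgebra n) (delPow u))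
        (hyperIdeal A β) := by
  refine Submodule.span_le.2 ?_
  rintro P (⟨s, t, hst, rfl⟩ | ⟨i, rfl⟩)
  · have e : (delPow s - delPow t) * delPow u = delPow u * (delPow s - delPow t) := by
      rw [sub_mul, mul_sub, delPow_mul_comm s, delPow_mul_comm t]
    change (delPow s - delPow t) * delPow u ∈ hyperIdeal A β
    rw [e]
    exact Ideal.mul_mem_left _ _ (Ideal.subset_span (Or.inl ⟨s, t, hst, rfl⟩))
  · have e : (euler A i - algebraMap ℂ (WeylAlgebra n) ((β - param (deg A u)) i)) * delPow u =
        delPow u * (euler A i - algebraMap ℂ (WeylAlgebra n) (β i)) := by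
      rw [sub_mul, euler_mul_delPow, Algebra.commutes, ← mul_sub, Pi.sub_apply, map_sub]
      congr 1
      abel
    change (euler A i - algebraMap ℂ (WeylAlgebra n) ((β - param (deg A u)) i)) * delPow u ∈
      hyperIdeal A β
    rw [e]
    exact Ideal.mul_mem_left _ _ (Ideal.subset_span (Or.inr ⟨i, rfl⟩))

/-- The contiguity map `M_A^{β - A·u} → M_A^β`, right multiplication by `∂^u`. -/
noncomputable def contiguityMap {d n : ℕ} (A : Matrix (Fin d) (Fin n) ℤ) (β : Fin d → ℂ)
    (u : Fin n → ℕ) :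
    HyperModule A (β - param (deg A u)) →ₗ[WeylAlgebra n] HyperModule A β :=
  Submodule.mapQ _ _ (LinearMap.toSpanSingleton (WeylAlgebra n) (WeylAlgebra n) (delPow u))
    (hyperIdeal_le_comap A β u)

/-- The contiguity map sends the class of `P` to the class of `P ∂^u`. -/
theorem contiguityMap_mk {d n : ℕ} (A : Matrix (Fin d) (Fin n) ℤ) (β : Fin d → ℂ)
    (u : Fin n → ℕ) (P : WeylAlgebra n) :
    contiguityMap A β u (Submodule.Quotient.mk P) = Submodule.Quotient.mk (P * delPow u) :=
  rfl

/-- The `D_A`-submodule of `M_A^0` generated by the class of `∂^v`. -/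
noncomputable def monomialSubmodule {d n : ℕ} (A : Matrix (Fin d) (Fin n) ℤ) (v : Fin n → ℕ) :
    Submodule (WeylAlgebra n) (HyperModule A 0) :=
  Submodule.span (WeylAlgebra n) {Submodule.Quotient.mk (delPow v)}

end GKZ

/-!
Let `a = A · u`. The contiguity map `· ∂^u : M_A^{β - a} → M_A^β` is inverted by means of a
`b`-polynomial: if `b ∈ ℂ[s_1, …, s_d]` vanishes at every `w ∈ ℕA` with `w - a ∉ ℕA`, then
`b(E) ≡ Q ∂^u` modulo the toric left ideal `D · I_A` for some homogeneous operator `Q` of weight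
`-a`. Indeed `b(E)` is a polynomial in the `θ_j = x_j ∂_j`, and by Newton interpolation on `ℕ^n`
it is a combination of those products `∏_j [θ_j]_{v_j} = x^v ∂^v` with `A · v - a ∈ ℕA`; for each of
these `∂^v` may be replaced by `∂^z ∂^u` with `A · z = A · v - a`. Since `∂^u` is a
nonzerodivisor from the right modulo `D · I_A`, right multiplication by `Q` is a well defined map
`M_A^β → M_A^{β - a}`, and both composites with the contiguity map are multiplication by `b(β)`.
The cancellation of `∂^u` is visible on the map `P ↦ P · exp(∑_j t^{a_j} x_j)`, whose kernel is
`D · I_A` and which turns right multiplication by `∂^u` into multiplication by the unit `t^a`.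

By saturation and Fourier–Motzkin elimination, `w ∈ ℤA` lies in `ℕA` as soon as finitely many linear
functionals `φ`, nonnegative on `ℕA`, are nonnegative at `w`. So `b` can be taken to be the product
of the factors `φ - r` over these `φ` and the finitely many values `r < φ(a)` of `φ` on `ℕA`. An
interior point `v` satisfies `φ(v) > 0` for every `φ` that contributes a factor, so
`φ(-v) < 0 ≤ r`, whence `b(-v) ≠ 0`.
-/

namespace GKZ

open MvPolynomial

section CommutingFamily

variable {σ R S : Type*} [CommRing R] [Ring S] [Algebra R S]

open scoped IsMulCommutative in
/-- Evaluation of polynomials at a family of commuting elements of a noncommutative algebra. -/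
noncomputable def aevalOfCommute (g : σ → S) (hg : ∀ i j, Commute (g i) (g j)) :
    MvPolynomial σ R →ₐ[R] S :=
  haveI : IsMulCommutative (Algebra.adjoin R (Set.range g)) :=
    Algebra.isMulCommutative_adjoin R <| Set.forall_mem_range.2 fun i =>
      Set.forall_mem_range.2 fun j => hg i j
  (Algebra.adjoin R (Set.range g)).val.comp
    (aeval fun i => ⟨g i, Algebra.subset_adjoin ⟨i, rfl⟩⟩)

theorem aevalOfCommute_X (g : σ → S) (hg : ∀ i j, Commute (g i) (g j)) (i : σ) :
    aevalOfCommute (R := R) g hg (X i) = g i := by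
  simp [aevalOfCommute]

/-- The substitution `X_i ↦ X_i + c_i`. -/
noncomputable def shift (c : σ → R) : MvPolynomial σ R →ₐ[R] MvPolynomial σ R :=
  aeval fun i => X i + C (c i)

theorem eval_shift (c w : σ → R) (p : MvPolynomial σ R) :
    eval w (shift c p) = eval (w + c) p := by
  change (aeval w).comp (shift c) p = aeval (w + c) p
  congr 1
  ext i
  simp [shift]

theorem mul_map_eq_map_shift_mul (f : MvPolynomial σ R →ₐ[R] S) {c : σ → R} {P : S}
    (hP : ∀ i, ⁅P, f (X i)⁆ = c i • P) (p : MvPolynomial σ R) :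
    P * f p = f (shift c p) * P := by
  induction p using MvPolynomial.induction_on with
  | C r => simp only [← algebraMap_eq, AlgHom.commutes, Algebra.commutes]
  | add p q hp hq => simp only [map_add, mul_add, add_mul, hp, hq]
  | mul_X p i hp =>
    have hX : P * f (X i) = f (shift c (X i)) * P := by
      rw [shift, aeval_X, map_add, ← algebraMap_eq, AlgHom.commutes, add_mul,
        ← Algebra.smul_def, ← hP i, Ring.lie_def]
      abel
    rw [map_mul, map_mul, map_mul, ← mul_assoc, hp, mul_assoc, hX, mul_assoc]

theorem map_sub_algebraMap_eval_mem (f : MvPolynomial σ R →ₐ[R] S) {J : Ideal S} {β : σ → R}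
    (hJ : ∀ i, f (X i) - algebraMap R S (β i) ∈ J) (p : MvPolynomial σ R) :
    f p - algebraMap R S (eval β p) ∈ J := by
  induction p using MvPolynomial.induction_on with
  | C r => simp [← algebraMap_eq]
  | add p q hp hq =>
    convert J.add_mem hp hq using 1
    simp only [map_add]
    abel
  | mul_X p i hp =>
    convert J.add_mem (J.mul_mem_left (f p) (hJ i)) (J.mul_mem_left (algebraMap R S (β i)) hp)
      using 1
    rw [map_mul, map_mul, eval_X, map_mul, ← Algebra.commutes (β i), mul_sub, mul_sub,
      Algebra.commutes (β i) (f p)]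
    abel

end CommutingFamily

section FallingPoly

variable {σ R : Type*}

theorem multiindex_induction {motive : (σ →₀ ℕ) → Prop} (zero : motive 0)
    (add_single : ∀ v i, motive v → motive (v + Finsupp.single i 1)) (v : σ →₀ ℕ) : motive v := by
  induction v using Finsupp.induction with
  | zero => exact zero
  | single_add i k v _ _ hv =>
    suffices h : ∀ m, motive (v + Finsupp.single i m) from add_comm v _ ▸ h k
    intro m
    induction m with
    | zero => simpa using hv
    | succ m ih => simpa [Finsupp.single_add, ← add_assoc] using add_single _ i ih

variable [CommRing R]

/-- The product `∏_j [X_j]_{v_j}` of falling factorials `[X]_k = X (X - 1) ⋯ (X - k + 1)`, the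
basis of Newton interpolation on the lattice points of the positive orthant. -/
noncomputable def fallingPoly (v : σ →₀ ℕ) : MvPolynomial σ R :=
  v.prod fun i k => Polynomial.aeval (X i) (descPochhammer R k)

theorem fallingPoly_zero : fallingPoly (0 : σ →₀ ℕ) = (1 : MvPolynomial σ R) :=
  Finsupp.prod_zero_index

theorem fallingPoly_add_single (v : σ →₀ ℕ) (j : σ) :
    (fallingPoly (v + Finsupp.single j 1) : MvPolynomial σ R) =
      fallingPoly v * (X j - C (v j : R)) := by
  have split (w : σ →₀ ℕ) := Finsupp.mul_prod_erase' w j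
    (fun i k => Polynomial.aeval (X i : MvPolynomial σ R) (descPochhammer R k)) (by simp)
  rw [fallingPoly, fallingPoly, ← split, ← split v, Finsupp.erase_add, Finsupp.erase_single,
    add_zero, Finsupp.add_apply, Finsupp.single_eq_same, descPochhammer_succ_right]
  simp only [map_mul, map_sub, Polynomial.aeval_X, map_natCast]
  ring

theorem eval_fallingPoly (v w : σ →₀ ℕ) :
    eval (fun i => (w i : R)) (fallingPoly v) = (v.prod fun i k => (w i).descFactorial k : ℕ) := by
  have factor (i : σ) (k : ℕ) : eval (fun i => (w i : R))
      (Polynomial.aeval (X i) (descPochhammer R k)) = ((w i).descFactorial k : R) := by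
    rw [← descPochhammer_eval_eq_descFactorial, ← coe_aeval_eq_eval, RingHom.coe_coe,
      ← Polynomial.aeval_algHom_apply, aeval_X, Polynomial.coe_aeval_eq_eval]
  simp only [fallingPoly, Finsupp.prod, map_prod, factor, Nat.cast_prod]

theorem eval_fallingPoly_of_not_le {v w : σ →₀ ℕ} (h : ¬v ≤ w) :
    eval (fun i => (w i : R)) (fallingPoly v) = 0 := by
  obtain ⟨i, hi⟩ : ∃ i, w i < v i := by simpa [Finsupp.le_def] using h
  rw [eval_fallingPoly, Finsupp.prod, Finset.prod_eq_zero (i := i), Nat.cast_zero]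
  · exact Finsupp.mem_support_iff.2 (Nat.ne_zero_of_lt hi)
  · exact Nat.descFactorial_of_lt hi

theorem eval_fallingPoly_self_ne_zero [CharZero R] (v : σ →₀ ℕ) :
    eval (fun i => (v i : R)) (fallingPoly v) ≠ 0 := by
  rw [eval_fallingPoly, Nat.cast_ne_zero, Finsupp.prod]
  simp [Finset.prod_ne_zero_iff, Nat.descFactorial_self, Nat.factorial_ne_zero]

theorem span_range_fallingPoly :
    Submodule.span R (Set.range (fallingPoly (σ := σ) (R := R))) = ⊤ := by
  refine Submodule.eq_top_iff'.2 fun p => ?_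
  induction p using MvPolynomial.induction_on with
  | C r =>
    rw [← mul_one (C r), ← smul_eq_C_mul, ← fallingPoly_zero]
    exact Submodule.smul_mem _ r (Submodule.subset_span ⟨0, rfl⟩)
  | add p q hp hq => exact Submodule.add_mem _ hp hq
  | mul_X p i hp =>
    induction hp using Submodule.span_induction with
    | mem p hp =>
      obtain ⟨v, rfl⟩ := hp
      have hX : (fallingPoly v * X i : MvPolynomial σ R) =
          fallingPoly (v + Finsupp.single i 1) + (v i : R) • fallingPoly v := by
        rw [fallingPoly_add_single, smul_eq_C_mul]
        ring
      rw [hX]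
      exact Submodule.add_mem _ (Submodule.subset_span ⟨_, rfl⟩)
        (Submodule.smul_mem _ _ (Submodule.subset_span ⟨v, rfl⟩))
    | zero => simp
    | add p q _ _ hp hq => exact add_mul p q (X i) ▸ Submodule.add_mem _ hp hq
    | smul c p _ hp => exact smul_mul_assoc c p (X i) ▸ Submodule.smul_mem _ c hp

-- The Newton coefficients of `p` are determined by its values through a triangular system.
theorem mem_span_fallingPoly_of_eval_eq_zero [CharZero R] [IsDomain R] {p : MvPolynomial σ R}
    {M : Set (σ →₀ ℕ)} (hM : IsUpperSet M) (hp : ∀ w ∉ M, eval (fun i => (w i : R)) p = 0) :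
    p ∈ Submodule.span R (fallingPoly '' M) := by
  obtain ⟨c, rfl⟩ := Finsupp.mem_span_range_iff_exists_finsupp.1
    (span_range_fallingPoly.ge (Submodule.mem_top (x := p)))
  suffices hc : ∀ w ∉ M, c w = 0 by
    refine Submodule.sum_mem _ fun v hv =>
      Submodule.smul_mem _ _ (Submodule.subset_span ⟨v, ?_, rfl⟩)
    by_contra hvM
    exact Finsupp.mem_support_iff.1 hv (hc v hvM)
  intro w
  induction w using WellFoundedLT.induction with
  | ind w ih =>
    intro hw
    have h := hp w hw
    rw [Finsupp.sum, map_sum, Finset.sum_eq_single w] at h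
    · simpa [eval_fallingPoly_self_ne_zero] using h
    · intro v _ hvw
      by_cases hle : v ≤ w
      · rw [ih v (lt_of_le_of_ne hle hvw) fun hv => hw (hM hle hv), zero_smul, map_zero]
      · rw [smul_eval, eval_fallingPoly_of_not_le hle, mul_zero]
    · intro hw'
      rw [Finsupp.notMem_support_iff.1 hw', zero_smul, map_zero]

end FallingPoly

section WeylAlgebra

variable {n : ℕ}

/-- The universal property of the Weyl algebra: operators `x_j`, `y_j` satisfying the relations of
`x_j`, `∂_j` define a representation. -/
noncomputable def weylLift {S : Type*} [Ring S] [Algebra ℂ S] (x y : Fin n → S)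
    (hx : ∀ i j, x i * x j = x j * x i) (hy : ∀ i j, y i * y j = y j * y i)
    (hyx : ∀ i j, y i * x j = x j * y i + if i = j then 1 else 0) : WeylAlgebra n →ₐ[ℂ] S :=
  RingQuot.liftAlgHom ℂ ⟨FreeAlgebra.lift ℂ (Sum.elim x y), by
    rintro _ _ (⟨i, j⟩ | ⟨i, j⟩ | ⟨i, j⟩)
    · simpa using hx i j
    · simpa using hy i j
    · have h := hyx i j
      split_ifs at h ⊢ <;> simpa using h⟩

theorem weylLift_coord {S : Type*} [Ring S] [Algebra ℂ S] (x y : Fin n → S) (hx hy hyx)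
    (j : Fin n) : weylLift x y hx hy hyx (coord j) = x j :=
  (RingQuot.liftAlgHom_mkAlgHom_apply _ _ _ _).trans (by simp)

theorem weylLift_del {S : Type*} [Ring S] [Algebra ℂ S] (x y : Fin n → S) (hx hy hyx)
    (j : Fin n) : weylLift x y hx hy hyx (del j) = y j :=
  (RingQuot.liftAlgHom_mkAlgHom_apply _ _ _ _).trans (by simp)

theorem eq_top_of_coord_mul_mem_of_del_mul_mem {S : Submodule ℂ (WeylAlgebra n)} (one : 1 ∈ S)
    (coord_mul : ∀ j, ∀ P ∈ S, coord j * P ∈ S) (del_mul : ∀ j, ∀ P ∈ S, del j * P ∈ S) :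
    S = ⊤ := by
  refine Submodule.eq_top_iff'.2 fun P => ?_
  obtain ⟨p, rfl⟩ : ∃ p, weylMk n p = P := RingQuot.mkAlgHom_surjective ℂ (WeylRel n) P
  suffices h : ∀ Q ∈ S, weylMk n p * Q ∈ S by simpa using h 1 one
  induction p using FreeAlgebra.induction with
  | grade0 r =>
    intro Q hQ
    rw [AlgHom.commutes, ← Algebra.smul_def]
    exact S.smul_mem r hQ
  | grade1 g => exact g.rec coord_mul del_mul
  | mul p q hp hq =>
    intro Q hQ
    rw [map_mul, mul_assoc]
    exact hp _ (hq _ hQ)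
  | add p q hp hq =>
    intro Q hQ
    rw [map_add, add_mul]
    exact S.add_mem (hp _ hQ) (hq _ hQ)

/-- The polynomial `p(x_1, …, x_n)` as an element of the Weyl algebra. -/
noncomputable def coordPoly : MvPolynomial (Fin n) ℂ →ₐ[ℂ] WeylAlgebra n :=
  aevalOfCommute coord coord_mul_coord

/-- The differential operator `p(∂_1, …, ∂_n)` with constant coefficients. -/
noncomputable def delPoly : MvPolynomial (Fin n) ℂ →ₐ[ℂ] WeylAlgebra n :=
  aevalOfCommute del del_mul_del

theorem coordPoly_X (j : Fin n) : coordPoly (X j) = coord j := aevalOfCommute_X ..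

theorem delPoly_X (j : Fin n) : delPoly (X j) = del j := aevalOfCommute_X ..

theorem delPow_eq_delPoly (u : Fin n → ℕ) : delPow u = delPoly (∏ j, X j ^ u j) := by
  simp [delPow, Fin.prod_univ_def, map_list_prod, Function.comp_def, delPoly_X]

theorem delPow_zero : delPow (0 : Fin n → ℕ) = 1 := by
  simp [delPow_eq_delPoly]

theorem delPow_add (u v : Fin n → ℕ) : delPow (u + v) = delPow u * delPow v := by
  simp [delPow_eq_delPoly, pow_add, Finset.prod_mul_distrib]

theorem delPow_single (j : Fin n) : delPow (Pi.single j 1) = del j := by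
  simp [delPow_eq_delPoly, Pi.single_apply, delPoly_X]

theorem coord_mul_coordPoly_monomial (j : Fin n) (v : Fin n →₀ ℕ) :
    coord j * coordPoly (monomial v 1) = coordPoly (monomial (v + Finsupp.single j 1) 1) := by
  rw [← coordPoly_X, ← map_mul, X, monomial_mul, mul_one, add_comm]

theorem del_mul_coordPoly (j : Fin n) (p : MvPolynomial (Fin n) ℂ) :
    del j * coordPoly p = coordPoly p * del j + coordPoly (pderiv j p) := by
  induction p using MvPolynomial.induction_on with
  | C r => simp [← algebraMap_eq, Algebra.commutes]
  | add p q hp hq =>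
    simp only [map_add, mul_add, add_mul, hp, hq]
    abel
  | mul_X p i hp =>
    have hX : coordPoly (pderiv j (X i)) = if j = i then (1 : WeylAlgebra n) else 0 := by
      rw [pderiv_X, Pi.single_apply, apply_ite coordPoly, map_one, map_zero]
      simp only [eq_comm]
    rw [map_mul, ← mul_assoc, hp, coordPoly_X, add_mul, mul_assoc, del_mul_coord, pderiv_mul,
      map_add, map_mul, map_mul, hX, coordPoly_X]
    noncomm_ring

/-- The normally ordered monomial `x^v ∂^w`. -/
noncomputable def normalMonomial (e : (Fin n →₀ ℕ) × (Fin n → ℕ)) : WeylAlgebra n :=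
  coordPoly (monomial e.1 1) * delPow e.2

theorem span_range_normalMonomial :
    Submodule.span ℂ (Set.range (normalMonomial (n := n))) = ⊤ := by
  set S := Submodule.span ℂ (Set.range (normalMonomial (n := n)))
  have mul_mem {Q : WeylAlgebra n} (h : ∀ e, Q * normalMonomial e ∈ S) : ∀ P ∈ S, Q * P ∈ S :=
    fun P hP => (Submodule.span_le (p := S.comap (LinearMap.mulLeft ℂ Q))).2
      (Set.range_subset_iff.2 h) hP
  have coordPoly_mul_delPow_mem (p : MvPolynomial (Fin n) ℂ) (w : Fin n → ℕ) :
      coordPoly p * delPow w ∈ S := by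
    induction p using MvPolynomial.induction_on' with
    | monomial v c =>
      have : monomial v c = c • monomial v (1 : ℂ) := by simp [smul_monomial]
      rw [this, map_smul, smul_mul_assoc]
      exact S.smul_mem c (Submodule.subset_span ⟨(v, w), rfl⟩)
    | add p q hp hq => simpa only [map_add, add_mul] using S.add_mem hp hq
  refine eq_top_of_coord_mul_mem_of_del_mul_mem ?_ (fun j => mul_mem fun e => ?_)
    fun j => mul_mem fun e => ?_
  · simpa [delPow_zero] using coordPoly_mul_delPow_mem 1 0
  · rw [normalMonomial, ← mul_assoc, ← coordPoly_X, ← map_mul]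
    exact coordPoly_mul_delPow_mem _ _
  · rw [normalMonomial, ← mul_assoc, del_mul_coordPoly, add_mul, mul_assoc, ← delPow_single,
      ← delPow_add]
    exact S.add_mem (coordPoly_mul_delPow_mem _ _) (coordPoly_mul_delPow_mem _ _)

/-- The operator `θ_j = x_j ∂_j`. -/
noncomputable def theta (j : Fin n) : WeylAlgebra n := coord j * del j

theorem commute_theta (i j : Fin n) : Commute (theta i) (theta j) := by
  rcases eq_or_ne i j with rfl | hij
  · rfl
  have hdx {i j : Fin n} (hij : i ≠ j) : Commute (del i) (coord j) :=
    (del_mul_coord i j).trans (by rw [if_neg hij, add_zero])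
  exact Commute.mul_left (Commute.mul_right (coord_mul_coord i j) (hdx hij.symm).symm)
    (Commute.mul_right (hdx hij) (del_mul_del i j))

theorem theta_mul_coordPoly_monomial (j : Fin n) (v : Fin n →₀ ℕ) :
    theta j * coordPoly (monomial v 1) =
      coordPoly (monomial v 1) * theta j + (v j : ℂ) • coordPoly (monomial v 1) := by
  have hv : (v j : ℂ) • monomial v (1 : ℂ) = X j * pderiv j (monomial v 1) := by
    rw [X_mul_pderiv_monomial, Nat.cast_smul_eq_nsmul]
  rw [theta, mul_assoc, del_mul_coordPoly, mul_add, ← map_smul, hv, ← coordPoly_X, ← mul_assoc,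
    ← map_mul, ← map_mul, ← mul_assoc, ← map_mul, mul_comm (X j)]

/-- The polynomial `p(θ_1, …, θ_n)`. -/
noncomputable def thetaPoly : MvPolynomial (Fin n) ℂ →ₐ[ℂ] WeylAlgebra n :=
  aevalOfCommute theta commute_theta

theorem thetaPoly_X (j : Fin n) : thetaPoly (X j) = theta j := aevalOfCommute_X ..

theorem thetaPoly_fallingPoly (v : Fin n →₀ ℕ) :
    thetaPoly (fallingPoly v) = normalMonomial (v, v) := by
  induction v using multiindex_induction with
  | zero => simp [fallingPoly_zero, normalMonomial, delPow_zero]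
  | add_single v j ih =>
    have hθ : theta j * normalMonomial (v, v) =
        normalMonomial (v + Finsupp.single j 1, Pi.single j 1 + ⇑v) +
          (v j : ℂ) • normalMonomial (v, v) := by
      have hcomm : coordPoly (monomial v 1) * coord j = coord j * coordPoly (monomial v 1) := by
        rw [← coordPoly_X, ← map_mul, ← map_mul, mul_comm]
      simp only [normalMonomial]
      rw [← mul_assoc, theta_mul_coordPoly_monomial, add_mul, smul_mul_assoc, theta, ← mul_assoc,
        hcomm, coord_mul_coordPoly_monomial, delPow_add, delPow_single, mul_assoc]
    rw [Finsupp.coe_add, Finsupp.single_eq_pi_single, add_comm (v : Fin n → ℕ),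
      fallingPoly_add_single, mul_comm, map_mul, ih, map_sub, thetaPoly_X, sub_mul, hθ,
      ← algebraMap_eq, AlgHom.commutes, ← Algebra.smul_def, add_sub_cancel_right]

end WeylAlgebra

theorem ker_le_of_linearIndependent_of_sub_mem {R M N ι κ : Type*} [Ring R] [AddCommGroup M]
    [Module R M] [AddCommGroup N] [Module R N] {e : ι → M} (he : Submodule.span R (Set.range e) = ⊤)
    {b : κ → N} (hb : LinearIndependent R b) {f : M →ₗ[R] N} {φ : ι → κ}
    (hf : ∀ i, f (e i) = b (φ i)) {K : Submodule R M} (hK : ∀ i j, φ i = φ j → e i - e j ∈ K) :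
    LinearMap.ker f ≤ K := by
  intro x hx
  obtain ⟨c, rfl⟩ := Finsupp.mem_span_range_iff_exists_finsupp.1 (he ▸ Submodule.mem_top : x ∈ _)
  change Finsupp.linearCombination R e c ∈ _ at hx
  have hc : Finsupp.mapDomain φ c = 0 := by
    refine linearIndependent_iff.1 hb _ ?_
    rw [Finsupp.linearCombination_mapDomain, ← LinearMap.mem_ker.1 hx,
      Finsupp.apply_linearCombination]
    exact congrArg (Finsupp.linearCombination R · c) (funext fun i => (hf i).symm)
  obtain ⟨g, hg⟩ := (Function.factorsThrough_iff (K.mkQ ∘ e)).1 fun i j hij =>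
    (Submodule.Quotient.eq K).2 (hK i j hij)
  rw [← Submodule.Quotient.mk_eq_zero]
  change K.mkQ (Finsupp.linearCombination R e c) = 0
  rw [Finsupp.apply_linearCombination, hg, ← Finsupp.linearCombination_mapDomain, hc, map_zero]

theorem pderiv_comm {σ R : Type*} [CommRing R] (i j : σ) (f : MvPolynomial σ R) :
    pderiv i (pderiv j f) = pderiv j (pderiv i f) := by
  classical
  have h : ⁅pderiv (R := R) i, pderiv j⁆ = 0 := derivation_ext fun k => by
    rw [Derivation.commutator_apply]
    simp [pderiv_X, Pi.single_apply, apply_ite]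
  have hf := DFunLike.congr_fun h f
  rwa [Derivation.commutator_apply, Derivation.zero_apply, sub_eq_zero] at hf

section ExponentialModule

variable {n : ℕ} {R : Type*} [CommRing R] [Algebra ℂ R]

/-- The action of the Weyl algebra on `R[x_1, …, x_n] · exp(∑ y_j x_j)`, written on the polynomial
factor: `x_j` acts by multiplication and `∂_j` by `∂/∂x_j + y_j`. -/
noncomputable def expAction (y : Fin n → R) :
    WeylAlgebra n →ₐ[ℂ] Module.End R (MvPolynomial (Fin n) R) :=
  weylLift (fun j => LinearMap.mulLeft R (X j)) (fun j => (pderiv j).toLinearMap + y j • 1)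
    (fun i j => LinearMap.ext fun f => by simp [mul_left_comm])
    (fun i j => LinearMap.ext fun f => by
      simp [smul_smul, mul_comm, pderiv_comm i j f, add_assoc, add_left_comm])
    (fun i j => LinearMap.ext fun f => by
      have h : (pderiv i (X j) : MvPolynomial (Fin n) R) = if i = j then 1 else 0 := by
        rw [pderiv_X, Pi.single_apply]
        simp only [eq_comm]
      split_ifs at h ⊢
      · simp [h, mul_add, add_assoc, add_comm, add_left_comm]
      · simp [h, mul_add])

theorem expAction_coord (y : Fin n → R) (j : Fin n) (f : MvPolynomial (Fin n) R) :
    expAction y (coord j) f = X j * f := by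
  rw [expAction, weylLift_coord, LinearMap.mulLeft_apply]

theorem expAction_del (y : Fin n → R) (j : Fin n) (f : MvPolynomial (Fin n) R) :
    expAction y (del j) f = pderiv j f + y j • f := by
  rw [expAction, weylLift_del]
  rfl

theorem expAction_coordPoly (y : Fin n → R) (p : MvPolynomial (Fin n) ℂ)
    (f : MvPolynomial (Fin n) R) :
    expAction y (coordPoly p) f = map (algebraMap ℂ R) p * f := by
  induction p using MvPolynomial.induction_on generalizing f with
  | C r => simp [← algebraMap_eq, Algebra.smul_def]
  | add p q hp hq => simp [hp, hq, add_mul]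
  | mul_X p i hp => simp [hp, coordPoly_X, expAction_coord, mul_assoc]

theorem expAction_delPoly_one (y : Fin n → R) (q : MvPolynomial (Fin n) ℂ) :
    expAction y (delPoly q) 1 = C (aeval y q) := by
  induction q using MvPolynomial.induction_on with
  | C r => simp [← algebraMap_eq, Algebra.smul_def]
  | add p q hp hq => simp [hp, hq]
  | mul_X p i hp =>
    have hi : expAction y (del i) 1 = y i • 1 := by simp [expAction_del]
    rw [map_mul, map_mul, Module.End.mul_apply, delPoly_X, hi, map_smul, hp, map_mul, aeval_X,
      map_mul, smul_eq_C_mul, mul_comm]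

end ExponentialModule

section ToricIdeal

variable {d n : ℕ} {A : Matrix (Fin d) (Fin n) ℤ}

/-- The left ideal `D · I_A` generated by the toric operators. -/
noncomputable def toricIdeal (A : Matrix (Fin d) (Fin n) ℤ) : Ideal (WeylAlgebra n) :=
  Ideal.span {P | ∃ s t : Fin n → ℕ, deg A s = deg A t ∧ P = delPow s - delPow t}

theorem delPow_sub_delPow_mem_toricIdeal {s t : Fin n → ℕ} (h : deg A s = deg A t) :
    delPow s - delPow t ∈ toricIdeal A :=
  Ideal.subset_span ⟨s, t, h, rfl⟩

theorem deg_add (u v : Fin n → ℕ) : deg A (u + v) = deg A u + deg A v := by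
  ext i
  simp [deg, mul_add, Finset.sum_add_distrib]

theorem deg_eq_sum (u : Fin n → ℕ) : deg A u = ∑ j, u j • column A j := by
  ext i
  simp [deg, column, mul_comm]

/-- The characters `t^{a_1}, …, t^{a_n}` of the torus, in the group algebra of `ℤ^d`. -/
noncomputable def toricPoint (A : Matrix (Fin d) (Fin n) ℤ) (j : Fin n) :
    AddMonoidAlgebra ℂ (Fin d → ℤ) :=
  AddMonoidAlgebra.single (column A j) 1

theorem linearIndependent_monomial_single {σ R G : Type*} [CommRing R] [AddCommMonoid G] :
    LinearIndependent R fun p : G × (σ →₀ ℕ) =>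
      (monomial p.2 (AddMonoidAlgebra.single p.1 1) : MvPolynomial σ (AddMonoidAlgebra R G)) := by
  convert ((AddMonoidAlgebra.basis G R).smulTower
    (basisMonomials σ (AddMonoidAlgebra R G))).linearIndependent with p
  simp [Module.Basis.smulTower_apply, AddMonoidAlgebra.basis, smul_monomial]

/-- The `ℂ`-linear map `P ↦ P · exp(∑ t^{a_j} x_j)`, whose kernel is the toric ideal. -/
noncomputable def toricSymbol (A : Matrix (Fin d) (Fin n) ℤ) :
    WeylAlgebra n →ₗ[ℂ] MvPolynomial (Fin n) (AddMonoidAlgebra ℂ (Fin d → ℤ)) :=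
  (LinearMap.applyₗ' ℂ 1).comp (expAction (toricPoint A)).toLinearMap

theorem toricSymbol_mul (P Q : WeylAlgebra n) :
    toricSymbol A (P * Q) = expAction (toricPoint A) P (toricSymbol A Q) := by
  change expAction (toricPoint A) (P * Q) 1 = _
  rw [map_mul]
  rfl

theorem toricSymbol_delPow (u : Fin n → ℕ) :
    toricSymbol A (delPow u) = C (AddMonoidAlgebra.single (deg A u) 1) := by
  have hprod : ∏ j, toricPoint A j ^ u j = AddMonoidAlgebra.single (deg A u) 1 := by
    simp [deg_eq_sum, toricPoint, AddMonoidAlgebra.prod_single, AddMonoidAlgebra.single_pow]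
  change expAction (toricPoint A) (delPow u) 1 = _
  rw [delPow_eq_delPoly, expAction_delPoly_one, map_prod, ← hprod]
  simp only [map_pow, aeval_X]

theorem toricSymbol_normalMonomial (e : (Fin n →₀ ℕ) × (Fin n → ℕ)) :
    toricSymbol A (normalMonomial e) = monomial e.1 (AddMonoidAlgebra.single (deg A e.2) 1) := by
  rw [normalMonomial, toricSymbol_mul, toricSymbol_delPow, expAction_coordPoly, map_monomial,
    map_one, mul_comm, C_mul_monomial, mul_one]

theorem toricIdeal_eq_ker_toricSymbol :
    (toricIdeal A).restrictScalars ℂ = LinearMap.ker (toricSymbol A) := by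
  apply le_antisymm
  · intro P hP
    rw [LinearMap.mem_ker]
    induction hP using Submodule.span_induction with
    | mem P hP =>
      obtain ⟨s, t, hst, rfl⟩ := hP
      rw [map_sub, toricSymbol_delPow, toricSymbol_delPow, hst, sub_self]
    | zero => rw [map_zero]
    | add P Q _ _ hP hQ => rw [map_add, hP, hQ, add_zero]
    | smul Q P _ hP => rw [smul_eq_mul, toricSymbol_mul, hP, map_zero]
  · refine ker_le_of_linearIndependent_of_sub_mem (φ := fun e => (deg A e.2, e.1))
      span_range_normalMonomial (linearIndependent_monomial_single (σ := Fin n) (R := ℂ)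
        (G := Fin d → ℤ)) toricSymbol_normalMonomial ?_
    rintro ⟨v, w⟩ ⟨v', w'⟩ h
    obtain ⟨hw, rfl⟩ := Prod.mk.inj h
    rw [normalMonomial, normalMonomial, ← mul_sub]
    exact Ideal.mul_mem_left _ _ (delPow_sub_delPow_mem_toricIdeal hw)

theorem mem_toricIdeal_iff {P : WeylAlgebra n} : P ∈ toricIdeal A ↔ toricSymbol A P = 0 := by
  rw [← LinearMap.mem_ker, ← toricIdeal_eq_ker_toricSymbol, Submodule.restrictScalars_mem]

theorem toricSymbol_mul_delPow (P : WeylAlgebra n) (u : Fin n → ℕ) :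
    toricSymbol A (P * delPow u) =
      AddMonoidAlgebra.single (deg A u) (1 : ℂ) • toricSymbol A P := by
  rw [toricSymbol_mul, toricSymbol_delPow, ← mul_one (C _), ← smul_eq_C_mul, map_smul]
  rfl

theorem mem_toricIdeal_of_mul_delPow_mem {P : WeylAlgebra n} {u : Fin n → ℕ}
    (h : P * delPow u ∈ toricIdeal A) : P ∈ toricIdeal A := by
  rw [mem_toricIdeal_iff, toricSymbol_mul_delPow] at h
  have hP := congrArg (AddMonoidAlgebra.single (-deg A u) (1 : ℂ) • ·) h
  rw [mem_toricIdeal_iff]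
  simpa [smul_smul, AddMonoidAlgebra.single_mul_single, ← AddMonoidAlgebra.one_def] using hP

end ToricIdeal

section EulerOperators

variable {d n : ℕ} {A : Matrix (Fin d) (Fin n) ℤ}

/-- The linear form `∑_j a_{ij} X_j`, whose value at `θ` is the Euler operator `E_i`. -/
noncomputable def eulerForm (A : Matrix (Fin d) (Fin n) ℤ) (i : Fin d) :
    MvPolynomial (Fin n) ℂ :=
  ∑ j, (A i j : ℂ) • X j

theorem eval_aeval_eulerForm (w : Fin n → ℕ) (p : MvPolynomial (Fin d) ℂ) :
    eval (fun j => (w j : ℂ)) (aeval (eulerForm A) p) = eval (param (deg A w)) p := by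
  change (aeval fun j => (w j : ℂ)).comp (aeval (eulerForm A)) p = aeval (param (deg A w)) p
  congr 1
  ext i
  simp [eulerForm, param, deg]

/-- The polynomial `p(E_1, …, E_d)` in the Euler operators. -/
noncomputable def eulerPoly (A : Matrix (Fin d) (Fin n) ℤ) :
    MvPolynomial (Fin d) ℂ →ₐ[ℂ] WeylAlgebra n :=
  thetaPoly.comp (aeval (eulerForm A))

theorem euler_eq_sum_smul_theta (i : Fin d) : euler A i = ∑ j, (A i j : ℂ) • theta j := by
  simp only [euler, theta, Algebra.smul_def]

theorem eulerPoly_X (i : Fin d) : eulerPoly A (X i) = euler A i := by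
  simp [eulerPoly, eulerForm, thetaPoly_X, euler_eq_sum_smul_theta]

/-- The operators `P` of weight `δ`, that is `P E_i = (E_i + δ_i) P`; thus `∂_j` has weight `a_j`
and `x_j` has weight `-a_j`. -/
noncomputable def weightSpace (A : Matrix (Fin d) (Fin n) ℤ) (δ : Fin d → ℂ) :
    Submodule ℂ (WeylAlgebra n) where
  carrier := {P | ∀ i, ⁅P, euler A i⁆ = δ i • P}
  zero_mem' i := by rw [Ring.lie_def, zero_mul, mul_zero, sub_zero, smul_zero]
  add_mem' hP hQ i := by
    rw [smul_add, ← hP i, ← hQ i]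
    simp only [Ring.lie_def]
    noncomm_ring
  smul_mem' c P hP i := by
    rw [smul_comm, ← hP i, Ring.lie_def, Ring.lie_def, smul_mul_assoc, mul_smul_comm, smul_sub]

theorem mul_mem_weightSpace {δ ε : Fin d → ℂ} {P Q : WeylAlgebra n} (hP : P ∈ weightSpace A δ)
    (hQ : Q ∈ weightSpace A ε) : P * Q ∈ weightSpace A (δ + ε) := fun i => by
  have hleibniz : ⁅P * Q, euler A i⁆ = P * ⁅Q, euler A i⁆ + ⁅P, euler A i⁆ * Q := by
    simp only [Ring.lie_def]
    noncomm_ring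
  rw [hleibniz, hP i, hQ i, mul_smul_comm, smul_mul_assoc, Pi.add_apply, add_smul, add_comm]

theorem delPow_mem_weightSpace (u : Fin n → ℕ) :
    (delPow u : WeylAlgebra n) ∈ weightSpace A (param (deg A u)) := fun i => by
  rw [Ring.lie_def, euler_mul_delPow, mul_sub, sub_sub_cancel, ← Algebra.commutes,
    Algebra.smul_def]

theorem coordPoly_monomial_mem_weightSpace (v : Fin n →₀ ℕ) :
    (coordPoly (monomial v 1) : WeylAlgebra n) ∈ weightSpace A (-param (deg A v)) := fun i => by
  have hE : euler A i * coordPoly (monomial v 1) = coordPoly (monomial v 1) * euler A i +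
      param (deg A v) i • coordPoly (monomial v 1) := by
    simp only [euler_eq_sum_smul_theta, Finset.sum_mul, Finset.mul_sum, smul_mul_assoc,
      mul_smul_comm, theta_mul_coordPoly_monomial, smul_add, Finset.sum_add_distrib, smul_smul,
      ← Finset.sum_smul]
    simp [param, deg]
  rw [Ring.lie_def, hE, Pi.neg_apply, neg_smul, sub_add_cancel_left]

theorem mul_eulerPoly {δ : Fin d → ℂ} {P : WeylAlgebra n} (hP : P ∈ weightSpace A δ)
    (p : MvPolynomial (Fin d) ℂ) : P * eulerPoly A p = eulerPoly A (shift δ p) * P :=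
  mul_map_eq_map_shift_mul (eulerPoly A) (fun i => by rw [eulerPoly_X, hP i]) p

end EulerOperators

section Contiguity

variable {d n : ℕ} {A : Matrix (Fin d) (Fin n) ℤ}

theorem mem_semigroup_iff {w : Fin d → ℤ} : w ∈ semigroup A ↔ ∃ z, deg A z = w := by
  simp only [semigroup, AddSubmonoid.mem_closure_range_iff_of_fintype, deg_eq_sum, eq_comm]

theorem deg_mem_semigroup (u : Fin n → ℕ) : deg A u ∈ semigroup A :=
  mem_semigroup_iff.2 ⟨u, rfl⟩

theorem toricIdeal_le_hyperIdeal (β : Fin d → ℂ) : toricIdeal A ≤ hyperIdeal A β :=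
  Ideal.span_mono Set.subset_union_left

theorem eulerPoly_sub_algebraMap_eval_mem (β : Fin d → ℂ) (p : MvPolynomial (Fin d) ℂ) :
    eulerPoly A p - algebraMap ℂ _ (eval β p) ∈ hyperIdeal A β :=
  map_sub_algebraMap_eval_mem (eulerPoly A)
    (fun i => Ideal.subset_span (Or.inr ⟨i, by rw [eulerPoly_X]⟩)) p

theorem exists_eulerPoly_sub_mul_delPow_mem {u : Fin n → ℕ} {b : MvPolynomial (Fin d) ℂ}
    (hb : ∀ w ∈ semigroup A, w - deg A u ∉ semigroup A → eval (param w) b = 0) :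
    ∃ Q ∈ weightSpace A (-param (deg A u)), eulerPoly A b - Q * delPow u ∈ toricIdeal A := by
  let M : Set (Fin n →₀ ℕ) := {v | deg A v - deg A u ∈ semigroup A}
  have hM : IsUpperSet M := by
    rintro v w hvw hv
    obtain ⟨z, rfl⟩ := exists_add_of_le hvw
    have hz : deg A (v + z : Fin n →₀ ℕ) - deg A u = deg A v - deg A u + deg A z := by
      rw [Finsupp.coe_add, deg_add]
      abel
    exact Set.mem_ofPred.2 (hz ▸ add_mem hv (deg_mem_semigroup _))
  have hspan : aeval (eulerForm A) b ∈ Submodule.span ℂ (fallingPoly '' M) :=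
    mem_span_fallingPoly_of_eval_eq_zero hM fun v hv => by
      rw [eval_aeval_eulerForm, hb _ (deg_mem_semigroup _) hv]
  have hle : Submodule.span ℂ (fallingPoly '' M) ≤
      ((weightSpace A (-param (deg A u))).map (LinearMap.mulRight ℂ (delPow u)) ⊔
        (toricIdeal A).restrictScalars ℂ).comap thetaPoly.toLinearMap := by
    rw [Submodule.span_le, Set.image_subset_iff]
    intro v hv
    obtain ⟨z, hz⟩ := mem_semigroup_iff.1 hv
    refine Submodule.mem_sup.2 ⟨_, ⟨coordPoly (monomial v 1) * delPow z, ?_, rfl⟩,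
      coordPoly (monomial v 1) * (delPow v - delPow (z + u)),
      Ideal.mul_mem_left _ _ (delPow_sub_delPow_mem_toricIdeal ?_), ?_⟩
    · have hweight : -param (deg A u) = -param (deg A v) + param (deg A z) := by
        ext i
        simp [hz, param, sub_eq_add_neg]
      rw [hweight]
      exact mul_mem_weightSpace (coordPoly_monomial_mem_weightSpace v) (delPow_mem_weightSpace z)
    · rw [deg_add, hz, sub_add_cancel]
    · change coordPoly (monomial v 1) * delPow z * delPow u + _ = thetaPoly (fallingPoly v)
      rw [thetaPoly_fallingPoly, delPow_add, mul_sub, mul_assoc, add_sub_cancel, normalMonomial]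
  obtain ⟨_, ⟨Q, hQ, rfl⟩, T, hT, hsum⟩ := Submodule.mem_sup.1 (hle hspan)
  refine ⟨Q, hQ, ?_⟩
  change Q * delPow u + T = eulerPoly A b at hsum
  rwa [← hsum, add_sub_cancel_left]

section Quotient

variable {u : Fin n → ℕ} {b : MvPolynomial (Fin d) ℂ} {Q : WeylAlgebra n}

theorem delPow_sub_delPow_mul_mem_toricIdeal
    (hQ : eulerPoly A b - Q * delPow u ∈ toricIdeal A) {s t : Fin n → ℕ}
    (hst : deg A s = deg A t) : (delPow s - delPow t) * Q ∈ toricIdeal A := by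
  refine mem_toricIdeal_of_mul_delPow_mem (u := u) ?_
  have hE : (delPow s - delPow t) * eulerPoly A b =
      eulerPoly A (shift (param (deg A s)) b) * (delPow s - delPow t) := by
    rw [sub_mul, mul_eulerPoly (delPow_mem_weightSpace s),
      mul_eulerPoly (delPow_mem_weightSpace t), hst, mul_sub]
  have hsplit : (delPow s - delPow t) * Q * delPow u =
      eulerPoly A (shift (param (deg A s)) b) * (delPow s - delPow t) -
        (delPow s - delPow t) * (eulerPoly A b - Q * delPow u) := by
    rw [← hE]
    noncomm_ring
  rw [hsplit]
  exact sub_mem (Ideal.mul_mem_left _ _ (delPow_sub_delPow_mem_toricIdeal hst))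
    (Ideal.mul_mem_left _ _ hQ)

theorem eulerPoly_shift_sub_delPow_mul_mem_toricIdeal
    (hQ : eulerPoly A b - Q * delPow u ∈ toricIdeal A) :
    eulerPoly A (shift (param (deg A u)) b) - delPow u * Q ∈ toricIdeal A := by
  refine mem_toricIdeal_of_mul_delPow_mem (u := u) ?_
  rw [sub_mul, ← mul_eulerPoly (delPow_mem_weightSpace u), mul_assoc, ← mul_sub]
  exact Ideal.mul_mem_left _ _ hQ

theorem hyperIdeal_le_comap_mul_right (hQ : eulerPoly A b - Q * delPow u ∈ toricIdeal A)
    (hweight : Q ∈ weightSpace A (-param (deg A u))) (β : Fin d → ℂ) :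
    hyperIdeal A β ≤ Submodule.comap (LinearMap.toSpanSingleton _ (WeylAlgebra n) Q)
      (hyperIdeal A (β - param (deg A u))) := by
  refine Submodule.span_le.2 ?_
  rintro P (⟨s, t, hst, rfl⟩ | ⟨i, rfl⟩)
  · exact toricIdeal_le_hyperIdeal _ (delPow_sub_delPow_mul_mem_toricIdeal hQ hst)
  · have hE : (euler A i - algebraMap ℂ _ (β i)) * Q =
        Q * (euler A i - algebraMap ℂ _ ((β - param (deg A u)) i)) := by
      have h := hweight i
      rw [Ring.lie_def, Pi.neg_apply, neg_smul, Algebra.smul_def, sub_eq_iff_eq_add,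
        neg_add_eq_sub, eq_sub_iff_add_eq] at h
      rw [sub_mul, ← h, Pi.sub_apply, map_sub, mul_sub, mul_sub, ← Algebra.commutes (β i),
        ← Algebra.commutes (param (deg A u) i)]
      abel
    change (euler A i - algebraMap ℂ _ (β i)) * Q ∈ hyperIdeal A (β - param (deg A u))
    rw [hE]
    exact Ideal.mul_mem_left _ _ (Ideal.subset_span (Or.inr ⟨i, rfl⟩))

end Quotient

theorem bijective_contiguityMap_of_eval_ne_zero {u : Fin n → ℕ} {b : MvPolynomial (Fin d) ℂ}
    (hb : ∀ w ∈ semigroup A, w - deg A u ∉ semigroup A → eval (param w) b = 0) {β : Fin d → ℂ}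
    (hβ : eval β b ≠ 0) : Function.Bijective (contiguityMap A β u) := by
  obtain ⟨Q, hweight, hQ⟩ := exists_eulerPoly_sub_mul_delPow_mem hb
  let g : HyperModule A β →ₗ[WeylAlgebra n] HyperModule A (β - param (deg A u)) :=
    Submodule.mapQ _ _ _ (hyperIdeal_le_comap_mul_right hQ hweight β)
  have mk_mul_eq_smul {γ : Fin d → ℂ} {p : MvPolynomial (Fin d) ℂ} {T : WeylAlgebra n}
      (hT : eulerPoly A p - T ∈ toricIdeal A) (P : WeylAlgebra n) :
      (Submodule.Quotient.mk (P * T) : HyperModule A γ) =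
        eval γ p • Submodule.Quotient.mk P := by
    rw [← Submodule.Quotient.mk_smul, Algebra.smul_def, Algebra.commutes, Submodule.Quotient.eq,
      ← mul_sub, ← sub_sub_sub_cancel_left _ _ (eulerPoly A p)]
    exact Ideal.mul_mem_left _ _
      (sub_mem (eulerPoly_sub_algebraMap_eval_mem γ p) (toricIdeal_le_hyperIdeal γ hT))
  have hfg (y : HyperModule A β) : contiguityMap A β u (g y) = eval β b • y := by
    obtain ⟨P, rfl⟩ := Submodule.Quotient.mk_surjective _ y
    change Submodule.Quotient.mk (P * Q * delPow u) = _
    rw [mul_assoc, mk_mul_eq_smul hQ]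
  have hgf (x : HyperModule A (β - param (deg A u))) :
      g (contiguityMap A β u x) = eval β b • x := by
    obtain ⟨P, rfl⟩ := Submodule.Quotient.mk_surjective _ x
    change Submodule.Quotient.mk (P * delPow u * Q) = _
    rw [mul_assoc, mk_mul_eq_smul (eulerPoly_shift_sub_delPow_mul_mem_toricIdeal hQ),
      eval_shift, sub_add_cancel]
  refine ⟨fun x x' h => ?_, fun y => ⟨g ((eval β b)⁻¹ • y), ?_⟩⟩
  · rw [← smul_right_inj hβ, ← hgf, ← hgf, h]
  · rw [hfg, smul_inv_smul₀ hβ]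

end Contiguity

section PolyhedralCone

variable {K M N : Type*} [Field K] [LinearOrder K] [IsStrictOrderedRing K]

theorem exists_nonneg_forall_mul_le_iff {ι : Type*} {s : Finset ι} {p q : ι → K} :
    (∃ t, 0 ≤ t ∧ ∀ k ∈ s, t * q k ≤ p k) ↔ (∀ k ∈ s, 0 ≤ q k → 0 ≤ p k) ∧
      ∀ k ∈ s, ∀ l ∈ s, q k < 0 → 0 < q l → q k * p l ≤ q l * p k := by
  classical
  constructor
  · rintro ⟨t, ht, h⟩
    refine ⟨fun k hk hq => (mul_nonneg ht hq).trans (h k hk), fun k hk l hl hqk hql => ?_⟩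
    calc q k * p l ≤ q k * (t * q l) := mul_le_mul_of_nonpos_left (h l hl) hqk.le
      _ = q l * (t * q k) := by ring
      _ ≤ q l * p k := mul_le_mul_of_nonneg_left (h k hk) hql.le
  · rintro ⟨hnonneg, helim⟩
    let lower : Finset K := insert 0 ((s.filter (q · < 0)).image fun k => p k / q k)
    have hlower : lower.Nonempty := Finset.insert_nonempty _ _
    refine ⟨lower.max' hlower, lower.le_max' 0 (Finset.mem_insert_self _ _), fun k hk => ?_⟩
    rcases lt_trichotomy (q k) 0 with hq | hq | hq
    · rw [← div_le_iff_of_neg hq]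
      exact lower.le_max' _ (Finset.mem_insert_of_mem
        (Finset.mem_image_of_mem _ (Finset.mem_filter.2 ⟨hk, hq⟩)))
    · simpa only [hq, mul_zero] using hnonneg k hk hq.ge
    · rw [← le_div_iff₀ hq]
      refine lower.max'_le hlower _ fun y hy => ?_
      rcases Finset.mem_insert.1 hy with rfl | hy
      · exact div_nonneg (hnonneg k hk hq.le) hq.le
      · obtain ⟨l, hl, rfl⟩ := Finset.mem_image.1 hy
        obtain ⟨hl, hql⟩ := Finset.mem_filter.1 hl
        rw [le_div_iff₀ hq, div_mul_eq_mul_div, div_le_iff_of_neg hql]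
        linarith [helim l hl k hk hql hq]

variable [AddCommGroup M] [Module K M] [AddCommGroup N] [Module K N]
  {p : M →ₗ[K] N →ₗ[K] K} {C : PointedCone K N}

theorem mem_hull_singleton_sup_dual_iff {S : Set M} {v y : N} :
    y ∈ PointedCone.hull K {v} ⊔ PointedCone.dual p S ↔
      ∃ t, 0 ≤ t ∧ ∀ F ∈ S, t * p F v ≤ p F y := by
  simp only [Submodule.mem_sup, Submodule.mem_span_singleton]
  constructor
  · rintro ⟨_, ⟨t, rfl⟩, z, hz, rfl⟩
    refine ⟨t, t.2, fun F hF => ?_⟩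
    change t * p F v ≤ p F ((t : K) • v + z)
    rw [map_add, map_smul, smul_eq_mul]
    exact le_add_of_nonneg_right (hz hF)
  · rintro ⟨t, ht, h⟩
    refine ⟨_, ⟨⟨t, ht⟩, rfl⟩, y - t • v, fun F hF => ?_, add_sub_cancel _ _⟩
    simpa using h F hF

-- Fourier–Motzkin elimination of `t` from the condition `y - t • v ∈ C`.
theorem dualFG_hull_singleton_sup (hC : C.DualFG p) (v : N) :
    (PointedCone.hull K {v} ⊔ C).DualFG p := by
  classical
  obtain ⟨S, rfl⟩ := hC
  let T : Finset M := S.filter (0 ≤ p · v) ∪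
    ((S ×ˢ S).filter fun F => p F.1 v < 0 ∧ 0 < p F.2 v).image
      fun F => p F.2 v • F.1 - p F.1 v • F.2
  refine ⟨T, ?_⟩
  ext y
  rw [mem_hull_singleton_sup_dual_iff]
  simp only [Finset.mem_coe]
  rw [exists_nonneg_forall_mul_le_iff]
  constructor
  · refine fun h => ⟨fun F hF hFv => ?_, fun F hF G hG hFv hGv => ?_⟩
    · exact h (Finset.mem_union_left _ (Finset.mem_filter.2 ⟨hF, hFv⟩))
    · have hFG := h (Finset.mem_union_right _ (Finset.mem_image_of_mem _
        (Finset.mem_filter.2 ⟨Finset.mk_mem_product hF hG, hFv, hGv⟩)))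
      simpa using hFG
  · rintro ⟨hnonneg, helim⟩ F hF
    rcases Finset.mem_union.1 hF with hF | hF
    · obtain ⟨hF, hFv⟩ := Finset.mem_filter.1 hF
      exact hnonneg F hF hFv
    · obtain ⟨⟨F, G⟩, hFG, rfl⟩ := Finset.mem_image.1 hF
      obtain ⟨hFG, hFv, hGv⟩ := Finset.mem_filter.1 hFG
      obtain ⟨hF, hG⟩ := Finset.mem_product.1 hFG
      simpa using helim F hF G hG hFv hGv

theorem dualFG_of_fg [Module.Finite K M] (hp : Function.Injective p.flip) (hC : C.FG) :
    C.DualFG p := by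
  classical
  obtain ⟨s, rfl⟩ := hC
  induction s using Finset.induction_on with
  | empty =>
    rw [Finset.coe_empty, Submodule.span_empty, ← Submodule.zero_eq_bot,
      ← PointedCone.dual_univ hp, ← Submodule.top_coe (R := {c : K // 0 ≤ c})]
    exact PointedCone.DualFG.dual_of_fg p Module.Finite.fg_top
  | insert v s _ ih =>
    rw [Finset.coe_insert, Submodule.span_insert]
    exact dualFG_hull_singleton_sup ih v

end PolyhedralCone

section ArchimedeanGroup

theorem finite_closure_range_inter_Iic {ι G : Type*} [Finite ι] [AddCommGroup G] [LinearOrder G]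
    [IsOrderedAddMonoid G] [Archimedean G] {c : ι → G} (hc : ∀ i, 0 ≤ c i) (B : G) :
    ((AddSubmonoid.closure (Set.range c) : Set G) ∩ Set.Iic B).Finite := by
  classical
  have := Fintype.ofFinite ι
  have truncation (i : ι) : ∃ k : ℕ, ∀ m : ℕ, m • c i ≤ B → min m k • c i = m • c i := by
    rcases (hc i).eq_or_lt with hi | hi
    · exact ⟨0, by simp [← hi]⟩
    · obtain ⟨k, hk⟩ := Archimedean.arch B hi
      refine ⟨k, fun m hm => ?_⟩
      rw [min_eq_left ((nsmul_le_nsmul_iff_left hi).1 (hm.trans hk))]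
  choose k hk using truncation
  refine ((Set.finite_Iic k).image fun w => ∑ i, w i • c i).subset ?_
  rintro _ ⟨hr, hB⟩
  obtain ⟨w, rfl⟩ := AddSubmonoid.mem_closure_range_iff_of_fintype.1 hr
  refine ⟨w ⊓ k, Set.mem_Iic.2 inf_le_right,
    Finset.sum_congr rfl fun i hi => hk i (w i) (le_trans ?_ hB)⟩
  exact Finset.single_le_sum (f := fun i => w i • c i) (fun j _ => nsmul_nonneg (hc j) _) hi

end ArchimedeanGroup

section LinearFunctionals

variable {d n : ℕ} {A : Matrix (Fin d) (Fin n) ℤ}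

/-- The embedding `ℤ^d → ℝ^d` as a homomorphism. -/
def realVec (d : ℕ) : (Fin d → ℤ) →+ (Fin d → ℝ) :=
  (Int.castAddHom ℝ).compLeft (Fin d)

theorem cone_eq_hull_range_column (A : Matrix (Fin d) (Fin n) ℤ) :
    cone A = PointedCone.hull ℝ (Set.range (realVec d ∘ column A)) := by
  ext y
  rw [SetLike.mem_coe, PointedCone.hull, Submodule.mem_span_range_iff_exists_fun]
  constructor
  · rintro ⟨c, hc, hy⟩
    refine ⟨fun j => ⟨c j, hc j⟩, ?_⟩
    ext i
    simp [hy, realVec, column, Nonneg.mk_smul]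
  · rintro ⟨c, rfl⟩
    refine ⟨fun j => c j, fun j => (c j).2, fun i => ?_⟩
    simp only [Finset.sum_apply]
    rfl

theorem exists_finset_forall_mem_cone_iff (A : Matrix (Fin d) (Fin n) ℤ) :
    ∃ T : Finset (Module.Dual ℝ (Fin d → ℝ)), ∀ y, y ∈ cone A ↔ ∀ F ∈ T, 0 ≤ F y := by
  have hfg : (PointedCone.hull ℝ (Set.range (realVec d ∘ column A))).FG :=
    Submodule.fg_span (Set.finite_range _)
  have hflip : Function.Injective (LinearMap.id (R := ℝ) (M := Module.Dual ℝ (Fin d → ℝ))).flip :=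
    Module.eval_apply_injective ℝ
  obtain ⟨T, hT⟩ := dualFG_of_fg hflip hfg
  refine ⟨T, fun y => ?_⟩
  rw [cone_eq_hull_range_column, ← hT]
  rfl

theorem pos_of_mem_interiorPoints {φ : Module.Dual ℝ (Fin d → ℝ)}
    (hφ : ∀ w ∈ semigroup A, 0 ≤ φ (realVec d w)) {a b : Fin d → ℤ} (ha : a ∈ semigroup A)
    (hφa : φ (realVec d a) ≠ 0) (hb : b ∈ interiorPoints A) : 0 < φ (realVec d b) := by
  refine (hφ b hb.1).lt_of_ne' fun hφb => ?_
  refine hb.2 _ ⟨φ, hφ, rfl⟩ (fun hF => hφa ?_) ⟨hb.1, hφb⟩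
  exact (hF.ge ha).2

theorem finite_image_semigroup_inter_Iio {ψ : (Fin d → ℤ) →+ ℝ}
    (hψ : ∀ w ∈ semigroup A, 0 ≤ ψ w) (B : ℝ) : (ψ '' semigroup A ∩ Set.Iio B).Finite := by
  have himage : ψ '' semigroup A = AddSubmonoid.closure (Set.range (ψ ∘ column A)) := by
    rw [Set.range_comp, ← AddMonoidHom.map_mclosure]
    rfl
  rw [himage]
  exact (finite_closure_range_inter_Iic
    (fun j => hψ _ (AddSubmonoid.subset_closure ⟨j, rfl⟩)) B).subset
    (Set.inter_subset_inter_right _ Set.Iio_subset_Iic_self)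

/-- The complex linear form that takes the values of the real functional `φ` at integer points. -/
noncomputable def dualForm (φ : Module.Dual ℝ (Fin d → ℝ)) : MvPolynomial (Fin d) ℂ :=
  ∑ i, C (φ (Pi.single i 1) : ℂ) * X i

theorem eval_param_dualForm (φ : Module.Dual ℝ (Fin d → ℝ)) (w : Fin d → ℤ) :
    eval (param w) (dualForm φ) = (φ (realVec d w) : ℂ) := by
  have hφ : φ (realVec d w) = ∑ i, (w i : ℝ) * φ (Pi.single i 1) := by
    conv_lhs => rw [← Finset.univ_sum_single (realVec d w), map_sum]
    refine Finset.sum_congr rfl fun i _ => ?_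
    rw [← smul_eq_mul, ← map_smul, ← Pi.single_smul, smul_eq_mul, mul_one]
    rfl
  simp [hφ, dualForm, param, mul_comm]

end LinearFunctionals

section BPolynomial

variable {d n : ℕ} {A : Matrix (Fin d) (Fin n) ℤ}

theorem exists_eval_param_eq_zero_of_lt {φ : Module.Dual ℝ (Fin d → ℝ)}
    (hφ : ∀ w ∈ semigroup A, 0 ≤ φ (realVec d w)) {a : Fin d → ℤ} (ha : a ∈ semigroup A) :
    ∃ q : MvPolynomial (Fin d) ℂ,
      (∀ w ∈ semigroup A, φ (realVec d w) < φ (realVec d a) → eval (param w) q = 0) ∧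
        ∀ v ∈ interiorPoints A, eval (param (-v)) q ≠ 0 := by
  let ψ : (Fin d → ℤ) →+ ℝ := φ.toAddMonoidHom.comp (realVec d)
  have hfinite : (ψ '' semigroup A ∩ Set.Iio (ψ a)).Finite :=
    finite_image_semigroup_inter_Iio hφ _
  refine ⟨∏ r ∈ hfinite.toFinset, (dualForm φ - C (r : ℂ)), fun w hw hlt => ?_, fun v hv => ?_⟩
  · rw [eval_prod]
    refine Finset.prod_eq_zero (hfinite.mem_toFinset.2 ⟨⟨w, hw, rfl⟩, hlt⟩) ?_
    rw [map_sub, eval_param_dualForm, eval_C]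
    exact sub_self _
  · rw [eval_prod]
    refine Finset.prod_ne_zero_iff.2 fun r hr => ?_
    obtain ⟨⟨w, hw, rfl⟩, hlt⟩ := hfinite.mem_toFinset.1 hr
    have hpos : 0 < φ (realVec d v) :=
      pos_of_mem_interiorPoints hφ ha ((hφ w hw).trans_lt hlt).ne' hv
    rw [map_sub, eval_param_dualForm, eval_C, map_neg, map_neg, ← Complex.ofReal_sub,
      Complex.ofReal_ne_zero]
    exact (sub_neg_of_lt ((neg_neg_of_pos hpos).trans_le (hφ w hw))).ne

theorem exists_bPolynomial (hA : IsSaturated A) {a : Fin d → ℤ} (ha : a ∈ semigroup A) :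
    ∃ b : MvPolynomial (Fin d) ℂ,
      (∀ w ∈ semigroup A, w - a ∉ semigroup A → eval (param w) b = 0) ∧
        ∀ v ∈ interiorPoints A, eval (param (-v)) b ≠ 0 := by
  obtain ⟨T, hT⟩ := exists_finset_forall_mem_cone_iff A
  have hnonneg : ∀ φ ∈ T, ∀ w ∈ semigroup A, 0 ≤ φ (realVec d w) := fun φ hφ w hw =>
    (hT _).1 ((hA w).2 hw).2 φ hφ
  choose! q hzero hne using fun φ hφ => exists_eval_param_eq_zero_of_lt (hnonneg φ hφ) ha
  refine ⟨∏ φ ∈ T, q φ, fun w hw hwa => ?_, fun v hv => ?_⟩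
  · have hlattice : w - a ∈ lattice A := by
      have hle : semigroup A ≤ (lattice A).toAddSubmonoid :=
        AddSubmonoid.closure_le.2 AddSubgroup.subset_closure
      exact sub_mem (hle hw) (hle ha)
    have hcone : realVec d (w - a) ∉ cone A := fun h => hwa ((hA _).1 ⟨hlattice, h⟩)
    obtain ⟨φ, hφ, hlt⟩ : ∃ φ ∈ T, φ (realVec d (w - a)) < 0 := by
      simpa only [hT, not_forall, exists_prop, not_le] using hcone
    rw [map_sub, map_sub, sub_neg] at hlt
    rw [eval_prod]
    exact Finset.prod_eq_zero hφ (hzero φ hφ w hw hlt)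
  · rw [eval_prod]
    exact Finset.prod_ne_zero_iff.2 fun φ hφ => hne φ hφ v hv

end BPolynomial

section InteriorParameters

variable {d n : ℕ} {A : Matrix (Fin d) (Fin n) ℤ}

theorem bijective_contiguityMap (hA : IsSaturated A) (u : Fin n → ℕ) {v : Fin d → ℤ}
    (hv : v ∈ interiorPoints A) : Function.Bijective (contiguityMap A (-param v) u) := by
  obtain ⟨b, hzero, hne⟩ := exists_bPolynomial hA (deg_mem_semigroup u)
  have hparam : param (-v) = -param v := funext fun i => Int.cast_neg (v i)
  exact bijective_contiguityMap_of_eval_ne_zero hzero (hparam ▸ hne v hv)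

theorem monomialSubmodule_eq_range (A : Matrix (Fin d) (Fin n) ℤ) (v : Fin n → ℕ) :
    monomialSubmodule A v = LinearMap.range (contiguityMap A 0 v) := by
  ext y
  rw [monomialSubmodule, Submodule.mem_span_singleton, LinearMap.mem_range,
    Submodule.Quotient.mk_surjective _ |>.exists]
  rfl

theorem monomialSubmodule_add (hA : IsSaturated A) (u : Fin n → ℕ) {v : Fin n → ℕ}
    (hv : deg A v ∈ interiorPoints A) :
    monomialSubmodule A (u + v) = monomialSubmodule A v := by
  refine le_antisymm ((Submodule.span_singleton_le_iff_mem _ _).2 ?_)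
    ((Submodule.span_singleton_le_iff_mem _ _).2 ?_)
  · refine Submodule.mem_span_singleton.2 ⟨delPow u, ?_⟩
    rw [delPow_add]
    rfl
  · obtain ⟨x, hx⟩ := (bijective_contiguityMap hA u hv).surjective (Submodule.Quotient.mk 1)
    obtain ⟨P, rfl⟩ := Submodule.Quotient.mk_surjective _ x
    rw [contiguityMap_mk, Submodule.Quotient.eq, ← zero_sub] at hx
    have hmul : (P * delPow u - 1) * delPow v ∈ hyperIdeal A 0 := hyperIdeal_le_comap A 0 v hx
    refine Submodule.mem_span_singleton.2 ⟨P, (Submodule.Quotient.eq _).2 ?_⟩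
    rwa [sub_mul, one_mul, mul_assoc, ← delPow_add] at hmul

end InteriorParameters

end GKZ

theorem mainTheorem10_general {d n : ℕ} (A : Matrix (Fin d) (Fin n) ℤ)
    (hsaturated : GKZ.IsSaturated A) :
    (∀ u v : Fin n → ℕ, GKZ.deg A v ∈ GKZ.interiorPoints A →
      Function.Bijective (GKZ.contiguityMap A (-GKZ.param (GKZ.deg A v)) u)) ∧
    (∀ v : Fin n → ℕ,
      GKZ.monomialSubmodule A v = LinearMap.range (GKZ.contiguityMap A 0 v)) ∧
    (∀ v v' : Fin n → ℕ, GKZ.deg A v ∈ GKZ.interiorPoints A →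
      GKZ.deg A v' ∈ GKZ.interiorPoints A →
      GKZ.monomialSubmodule A v = GKZ.monomialSubmodule A v') := by
  refine ⟨fun u v hv => GKZ.bijective_contiguityMap hsaturated u hv,
    GKZ.monomialSubmodule_eq_range A, fun v v' hv hv' => ?_⟩
  rw [← GKZ.monomialSubmodule_add hsaturated v' hv, add_comm,
    GKZ.monomialSubmodule_add hsaturated v hv']

theorem mainTheorem10 {d n : ℕ} (A : Matrix (Fin d) (Fin n) ℤ)
    (hpointed : GKZ.IsPointed A) (hsaturated : GKZ.IsSaturated A) :
    (∀ u v : Fin n → ℕ, GKZ.deg A v ∈ GKZ.interiorPoints A →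
      Function.Bijective (GKZ.contiguityMap A (-GKZ.param (GKZ.deg A v)) u)) ∧
    (∀ v : Fin n → ℕ, GKZ.deg A v ∈ GKZ.interiorPoints A →
      GKZ.monomialSubmodule A v = LinearMap.range (GKZ.contiguityMap A 0 v)) ∧
    (∀ v v' : Fin n → ℕ, GKZ.deg A v ∈ GKZ.interiorPoints A →
      GKZ.deg A v' ∈ GKZ.interiorPoints A →
      GKZ.monomialSubmodule A v = GKZ.monomialSubmodule A v') := by
  have h := mainTheorem10_general A hsaturated
  exact ⟨h.1, fun v _ => h.2.1 v, h.2.2⟩
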